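/- Let $\mathbb K$ be $\mathbb R$ or $\mathbb C$, let $\mathcal O=\mathbb K\{x\}$ and $\widetilde{\mathcal O}=\mathbb K[[x]]$ be the rings of convergent and of formal power series in $x=(x_1,\dots,x_n)$, and let $\mathcal D$ and $\widetilde{\mathcal D}$ be the modules of logarithmic derivations of $\mathcal O$ and $\widetilde{\mathcal O}$, i.e. the free modules with basis $x_1\partial_{x_1},\dots,x_n\partial_{x_n}$. For an element $m$ of a free module with a finite basis, $\Gamma(m)$ denotes the ideal generated by its coefficients in a basis. Every $\delta\in\widetilde{\mathcal D}$ has a unique Jordan decomposition $\delta=\delta_{\rm ss}+\delta_{\rm nilp}$ with $\delta_{\rm ss},\delta_{\rm nilp}\in\widetilde{\mathcal D}$ commuting and acting respectively as a semi-simple and as a nilpotent endomorphism on $\widetilde{\mathcal O}/(x_1,\dots,x_n)^{k+1}$ for every $k\ge 0$. The Bruno ideal of $\delta$ is $B(\delta)=\Gamma(\delta_{\rm ss}\wedge\delta_{\rm nilp})\subset\widetilde{\mathcal O}$. Let $S=\sum_i\lambda_i x_i\partial_{x_i}$ with $0\ne\lambda\in\mathbb K^n$, let $R=\sum_i r_i\,x_i\partial_{x_i}$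 with $r_i\in\mathcal O$ and $r_i(0)=0$ for all $i$, and let $\partial=S+R$. Suppose that $\partial$ is in normal form modulo $B(\partial)$, that is, $S(B(\partial))\subset B(\partial)$ and $\partial_{\rm ss}$ equals $S$ modulo $B(\partial)$ as a logarithmic derivation: $\partial_{\rm ss}-S\in B(\partial)\,\widetilde{\mathcal D}$. Let $I\subset\mathcal O$ be the smallest ideal of $\mathcal O$ that contains $\Gamma(S\wedge R)+\Gamma([S,R])$ (ideals of $\mathcal O$, formed in $\mathcal D\wedge\mathcal D$ and $\mathcal D$) and is stable under $S$. Then $$B(\partial)=I\,\widetilde{\mathcal O}.$$ In particular $B(\partial)$ is an analytic ideal, i.e. it is generated by convergent power series. No arithmetic condition on $\lambda$ is imposed. -/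

import Mathlib

open MvPowerSeries

noncomputable section

namespace LogField

/-! ### Formal and convergent power series -/

/-- The ring of formal power series in `x₁, …, xₙ` with coefficients in `𝕜`. -/
abbrev Formal (n : ℕ) (𝕜 : Type*) [RCLike 𝕜] : Type _ := MvPowerSeries (Fin n) 𝕜

section Series

variable {n : ℕ} {𝕜 : Type*} [RCLike 𝕜]

/-- A series is convergent if it has a finite majorant norm `∑ |a_m| r ^ |m|` for some radius
`r > 0`, i.e. if it is the Taylor series of an analytic germ at the origin. -/
def IsConvergent (f : Formal n 𝕜) : Prop :=
  ∃ r : ℝ, 0 < r ∧ Summable fun m : Fin n →₀ ℕ => ‖coeff m f‖ * r ^ m.degree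

theorem IsConvergent.mono {f : Formal n 𝕜} {r s : ℝ} (hs : 0 < s) (hsr : s ≤ r)
    (h : Summable fun m : Fin n →₀ ℕ => ‖coeff m f‖ * r ^ m.degree) :
    Summable fun m : Fin n →₀ ℕ => ‖coeff m f‖ * s ^ m.degree := by
  refine Summable.of_nonneg_of_le (fun m => by positivity) (fun m => ?_) h
  gcongr

theorem isConvergent_C (c : 𝕜) : IsConvergent (C c : Formal n 𝕜) := by
  classical
  refine ⟨1, one_pos, summable_of_hasFiniteSupport ((Set.finite_singleton 0).subset ?_)⟩
  intro m hm
  by_contra h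
  apply hm
  have h0 : m ≠ 0 := h
  simp [coeff_C, h0]

theorem IsConvergent.add {f g : Formal n 𝕜} (hf : IsConvergent f) (hg : IsConvergent g) :
    IsConvergent (f + g) := by
  obtain ⟨r, hr, hf⟩ := hf
  obtain ⟨s, hs, hg⟩ := hg
  have hrs : 0 < min r s := lt_min hr hs
  refine ⟨min r s, hrs, Summable.of_nonneg_of_le (fun m => by positivity) (fun m => ?_)
    ((IsConvergent.mono hrs (min_le_left r s) hf).add
      (IsConvergent.mono hrs (min_le_right r s) hg))⟩
  rw [map_add, ← add_mul]
  gcongr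
  exact norm_add_le _ _

theorem summable_cauchy {F G : (Fin n →₀ ℕ) → ℝ} (hF : Summable F) (hG : Summable G)
    (hF0 : ∀ m, 0 ≤ F m) (hG0 : ∀ m, 0 ≤ G m) :
    Summable fun m => ∑ p ∈ Finset.HasAntidiagonal.antidiagonal m, F p.1 * G p.2 :=
  summable_sum_mul_antidiagonal_of_summable_mul (Summable.mul_of_nonneg hF hG hF0 hG0)

theorem norm_coeff_mul_le (f g : Formal n 𝕜) {t : ℝ} (ht : 0 < t) (m : Fin n →₀ ℕ) :
    ‖coeff m (f * g)‖ * t ^ m.degree ≤ ∑ p ∈ Finset.HasAntidiagonal.antidiagonal m,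
      (‖coeff p.1 f‖ * t ^ p.1.degree) * (‖coeff p.2 g‖ * t ^ p.2.degree) := by
  rw [coeff_mul]
  refine (mul_le_mul_of_nonneg_right (norm_sum_le _ _) (by positivity)).trans_eq ?_
  rw [Finset.sum_mul]
  refine Finset.sum_congr rfl fun p hp => ?_
  rw [← Finset.HasAntidiagonal.mem_antidiagonal.mp hp, map_add, pow_add, norm_mul]
  ring

theorem IsConvergent.mul {f g : Formal n 𝕜} (hf : IsConvergent f) (hg : IsConvergent g) :
    IsConvergent (f * g) := by
  obtain ⟨r, hr, hf⟩ := hf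
  obtain ⟨s, hs, hg⟩ := hg
  have ht : 0 < min r s := lt_min hr hs
  have hfg := summable_cauchy (IsConvergent.mono ht (min_le_left r s) hf)
    (IsConvergent.mono ht (min_le_right r s) hg)
    (fun m => mul_nonneg (norm_nonneg _) (pow_nonneg ht.le _))
    (fun m => mul_nonneg (norm_nonneg _) (pow_nonneg ht.le _))
  exact ⟨min r s, ht, Summable.of_nonneg_of_le
    (fun m => mul_nonneg (norm_nonneg _) (pow_nonneg ht.le _))
    (fun m => norm_coeff_mul_le f g ht m) hfg⟩

variable (n 𝕜) in
/-- The ring `𝒪 = 𝕜{x₁, …, xₙ}` of convergent power series, as a subring of the formal ones. -/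
def Conv : Subalgebra 𝕜 (Formal n 𝕜) where
  carrier := {f | IsConvergent f}
  mul_mem' := IsConvergent.mul
  add_mem' := IsConvergent.add
  algebraMap_mem' c := isConvergent_C c

/-! ### The derivations `x_i ∂/∂x_i` -/

/-- The derivation `x_i ∂/∂x_i` of the ring of formal power series. -/
def euler (i : Fin n) : Derivation 𝕜 (Formal n 𝕜) (Formal n 𝕜) :=
  (X i : Formal n 𝕜) • pderiv 𝕜 i

theorem coeff_euler (i : Fin n) (f : Formal n 𝕜) (m : Fin n →₀ ℕ) :
    coeff m (euler i f) = (m i : 𝕜) * coeff m f := by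
  classical
  have h : euler i f = X i * pderiv 𝕜 i f := rfl
  rw [h, X, coeff_monomial_mul]
  by_cases hm : Finsupp.single i 1 ≤ m
  · have h1 : 1 ≤ m i := by simpa using hm i
    rw [if_pos hm, coeff_pderiv, tsub_add_cancel_of_le hm]
    simp [Nat.cast_sub h1, mul_comm]
  · have h1 : m i = 0 := by
      by_contra h0
      exact hm (Finsupp.single_le_iff.mpr (Nat.one_le_iff_ne_zero.mpr h0))
    rw [if_neg hm, h1]
    simp

theorem IsConvergent.euler {f : Formal n 𝕜} (hf : IsConvergent f) (i : Fin n) :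
    IsConvergent (euler i f) := by
  obtain ⟨r, hr, hf⟩ := hf
  refine ⟨r / 2, by positivity,
    Summable.of_nonneg_of_le (fun m => by positivity) (fun m => ?_) hf⟩
  have h1 : (m i : ℝ) ≤ 2 ^ m.degree := by
    have h2 : m i ≤ 2 ^ m.degree := (Finsupp.le_degree i m).trans Nat.lt_two_pow_self.le
    exact_mod_cast h2
  rw [coeff_euler, norm_mul, RCLike.norm_natCast, div_pow]
  calc (m i : ℝ) * ‖coeff m f‖ * (r ^ m.degree / 2 ^ m.degree)
      ≤ 2 ^ m.degree * ‖coeff m f‖ * (r ^ m.degree / 2 ^ m.degree) := by gcongr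
    _ = ‖coeff m f‖ * r ^ m.degree := by field_simp

/-- The derivation `x_i ∂/∂x_i` of the ring of convergent power series. -/
def eulerConv (i : Fin n) : Derivation 𝕜 (Conv n 𝕜) (Conv n 𝕜) where
  toFun f := ⟨euler i f.1, f.2.euler i⟩
  map_add' f g := Subtype.ext (by simp)
  map_smul' c f := Subtype.ext (by simp)
  map_one_eq_zero' := Subtype.ext (by simp)
  leibniz' f g := Subtype.ext (by simp)

theorem euler_comm (i j : Fin n) :
    ⁅(euler i : Derivation 𝕜 (Formal n 𝕜) (Formal n 𝕜)), (euler j : Derivation 𝕜 _ _)⁆ = 0 := by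
  ext f m
  rw [Derivation.commutator_apply, map_sub]
  simp only [coeff_euler, Derivation.coe_zero, Pi.zero_apply, map_zero]
  ring

theorem eulerConv_comm (i j : Fin n) :
    ⁅(eulerConv i : Derivation 𝕜 (Conv n 𝕜) (Conv n 𝕜)), (eulerConv j : Derivation 𝕜 _ _)⁆ = 0 := by
  ext f : 2
  rw [Derivation.commutator_apply]
  have h : ⁅(euler i : Derivation 𝕜 (Formal n 𝕜) (Formal n 𝕜)), (euler j : Derivation 𝕜 _ _)⁆ f.1 = 0 := by rw [euler_comm]; rfl
  rw [Derivation.commutator_apply] at h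
  exact h

end Series

/-! ### Logarithmic derivations

The logarithmic derivations of `A`, where `A` is the ring of formal or of convergent power series,
form the free `A`-module with basis `E i = x_i ∂/∂x_i`. The derivation `∑ a_i x_i ∂/∂x_i` is
recorded by its coefficient vector `a : Fin n → A`. -/

section Log

variable {n : ℕ} {𝕜 A : Type*} [CommRing 𝕜] [CommRing A] [Algebra 𝕜 A]

/-- The derivation `∑ a_i E_i` with coefficient vector `a`. -/
def derivOf (E : Fin n → Derivation 𝕜 A A) (a : Fin n → A) : Derivation 𝕜 A A :=
  ∑ i, a i • E i

/-- The coefficient vector of the Lie bracket of `∑ a_i E_i` and `∑ b_i E_i`,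
for commuting `E_i`. -/
def bracket (E : Fin n → Derivation 𝕜 A A) (a b : Fin n → A) : Fin n → A :=
  fun i => derivOf E a (b i) - derivOf E b (a i)

theorem derivOf_apply (E : Fin n → Derivation 𝕜 A A) (a : Fin n → A) (f : A) :
    derivOf E a f = ∑ i, a i * E i f := by
  rw [derivOf, ← Derivation.coeFnAddMonoidHom_apply, map_sum, Finset.sum_apply]
  rfl

theorem derivOf_bracket (E : Fin n → Derivation 𝕜 A A) (hE : ∀ i j, ⁅E i, E j⁆ = 0)
    (a b : Fin n → A) :
    derivOf E (bracket E a b) = ⁅derivOf E a, derivOf E b⁆ := by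
  have hE' : ∀ i j f, E i (E j f) = E j (E i f) := fun i j f => by
    have h := congrArg (fun d => d f) (hE i j)
    simpa [Derivation.commutator_apply, sub_eq_zero] using h
  ext f
  rw [Derivation.commutator_apply, derivOf_apply E (bracket E a b),
    derivOf_apply E b f, derivOf_apply E a f]
  simp only [bracket, map_sum, Derivation.leibniz, smul_eq_mul, sub_mul,
    Finset.sum_sub_distrib, Finset.sum_add_distrib]
  have key : ∑ j, b j * derivOf E a (E j f) = ∑ j, a j * derivOf E b (E j f) := by
    simp only [derivOf_apply, Finset.mul_sum]
    rw [Finset.sum_comm]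
    refine Finset.sum_congr rfl fun i _ => Finset.sum_congr rfl fun j _ => ?_
    rw [hE' i j]
    ring
  rw [key]
  simp only [mul_comm (E _ f)]
  ring

/-- The coefficient ideal of a vector: the ideal generated by its coordinates. -/
def coeffIdeal {ι : Type*} (v : ι → A) : Ideal A :=
  Ideal.span (Set.range v)

/-- The ideal of collinearity `Γ(a ∧ b)`: the coefficient ideal of
`a ∧ b = ∑_{i < j} (a_i b_j - a_j b_i) E_i ∧ E_j`. -/
def collinearityIdeal (a b : Fin n → A) : Ideal A :=
  coeffIdeal fun p : Fin n × Fin n => a p.1 * b p.2 - a p.2 * b p.1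

/-- The ideal of commutativity `Γ([a, b])`: the coefficient ideal of the Lie bracket. -/
def commutativityIdeal (E : Fin n → Derivation 𝕜 A A) (a b : Fin n → A) : Ideal A :=
  coeffIdeal (bracket E a b)

/-- The differential closure `δ[J]`: the smallest `δ`-stable ideal containing `J`. -/
def diffClosure (δ : Derivation 𝕜 A A) (J : Ideal A) : Ideal A :=
  sInf {K : Ideal A | J ≤ K ∧ ∀ f ∈ K, δ f ∈ K}

/-- The coefficient vector of the diagonal derivation `L(λ) = ∑ λ_i x_i ∂/∂x_i`. -/
def diag (lam : Fin n → 𝕜) : Fin n → A :=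
  fun i => algebraMap 𝕜 A (lam i)

end Log

/-! ### Jordan decomposition -/

section Jordan

variable {n : ℕ} {𝕜 : Type*} [RCLike 𝕜]

variable (n 𝕜) in
/-- The maximal ideal `𝔪 = (x₁, …, xₙ)` of the ring of formal power series. -/
def maxIdeal : Ideal (Formal n 𝕜) :=
  Ideal.span (Set.range fun i : Fin n => (X i : Formal n 𝕜))

theorem derivOf_mem_maxIdeal (d : Fin n → Formal n 𝕜) {f : Formal n 𝕜} :
    derivOf euler d f ∈ maxIdeal n 𝕜 := by
  rw [derivOf_apply]
  refine Ideal.sum_mem _ fun i _ => Ideal.mul_mem_left _ _ ?_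
  have h : euler i f = X i * pderiv 𝕜 i f := rfl
  rw [h]
  exact Ideal.mul_mem_right _ _ (Ideal.subset_span ⟨i, rfl⟩)

theorem derivOf_mem_pow (d : Fin n → Formal n 𝕜) (k : ℕ) :
    ∀ f ∈ maxIdeal n 𝕜 ^ k, derivOf euler d f ∈ maxIdeal n 𝕜 ^ k := by
  induction k with
  | zero => simp
  | succ k ih =>
    intro f hf
    rw [pow_succ] at hf ⊢
    induction hf using Submodule.mul_induction_on' with
    | mem_mul_mem a ha b hb =>
      rw [Derivation.leibniz]
      refine add_mem (Ideal.mul_mem_mul ha (derivOf_mem_maxIdeal d)) ?_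
      rw [smul_eq_mul, mul_comm b]
      exact Ideal.mul_mem_mul (ih a ha) hb
    | add a _ b _ ha hb =>
      rw [map_add]
      exact add_mem ha hb

/-- The `k`-jets `𝕜[[x]] / 𝔪 ^ (k + 1)`, as a vector space over `𝕜`. -/
abbrev Jet (n : ℕ) (𝕜 : Type*) [RCLike 𝕜] (k : ℕ) : Type _ :=
  Formal n 𝕜 ⧸ (maxIdeal n 𝕜 ^ (k + 1)).restrictScalars 𝕜

/-- The endomorphism of the space of `k`-jets induced by a logarithmic derivation. -/
def jetMap (d : Fin n → Formal n 𝕜) (k : ℕ) : Module.End 𝕜 (Jet n 𝕜 k) :=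
  Submodule.mapQ _ _ (derivOf euler d : Formal n 𝕜 →ₗ[𝕜] Formal n 𝕜)
    (fun f hf => derivOf_mem_pow d (k + 1) f hf)

/-- A derivation is semi-simple if it is semi-simple on every jet space. -/
def IsSemisimpleDer (d : Fin n → Formal n 𝕜) : Prop :=
  ∀ k, (jetMap d k).IsSemisimple

/-- A derivation is nilpotent if it is nilpotent on every jet space. -/
def IsNilpotentDer (d : Fin n → Formal n 𝕜) : Prop :=
  ∀ k, IsNilpotent (jetMap d k)

/-- `d = s + t` is the Jordan decomposition of `d`. -/
structure IsJordanDecomposition (d s t : Fin n → Formal n 𝕜) : Prop where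
  add_eq : s + t = d
  semisimple : IsSemisimpleDer s
  nilpotent : IsNilpotentDer t
  commute : ⁅derivOf euler s, derivOf euler t⁆ = 0

open Classical in
/-- The semi-simple component of `d`. The Jordan decomposition of a formal logarithmic derivation
exists and is unique, so this is the component in the usual sense; the value `0` is never used. -/
def ssPart (d : Fin n → Formal n 𝕜) : Fin n → Formal n 𝕜 :=
  if h : ∃ s, ∃ t, IsJordanDecomposition d s t then h.choose else 0

/-- The nilpotent component of `d`. -/
def nilpPart (d : Fin n → Formal n 𝕜) : Fin n → Formal n 𝕜 :=
  d - ssPart d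

/-- The Bruno ideal `B(d) = Γ(d_ss ∧ d_nilp)`. -/
def brunoIdeal (d : Fin n → Formal n 𝕜) : Ideal (Formal n 𝕜) :=
  collinearityIdeal (ssPart d) (nilpPart d)

/-- An `L(λ)`-perturbation `d` is in normal form modulo a `d`-invariant ideal `I` if `I` is
`L(λ)`-invariant and `d_ss = L(λ)` modulo `I`, as an equality of logarithmic derivations, i.e. in
the quotient of the module of logarithmic derivations by `I` times this module. -/
structure IsNormalFormModulo (lam : Fin n → 𝕜) (d : Fin n → Formal n 𝕜)
    (I : Ideal (Formal n 𝕜)) : Prop where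
  invariant : ∀ f ∈ I, derivOf euler (diag lam : Fin n → Formal n 𝕜) f ∈ I
  congruent : ssPart d - diag lam ∈ I • (⊤ : Submodule (Formal n 𝕜) (Fin n → Formal n 𝕜))

/-! ### Analytic derivations and ideals -/

/-- The extension of an analytic logarithmic derivation to formal power series. -/
def toFormal (d : Fin n → Conv n 𝕜) : Fin n → Formal n 𝕜 :=
  fun i => (d i : Formal n 𝕜)

/-- The ideal of formal power series generated by an ideal of convergent ones. -/
def extend (I : Ideal (Conv n 𝕜)) : Ideal (Formal n 𝕜) :=
  I.map (Conv n 𝕜).val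

/-- An ideal of formal power series is analytic if it is generated by convergent series. -/
def IsAnalyticIdeal (J : Ideal (Formal n 𝕜)) : Prop :=
  ∃ I : Ideal (Conv n 𝕜), J = extend I

end Jordan

end LogField

end

noncomputable section

namespace LogField

/-! ### Jordan–Chevalley decomposition relative to invariant subspaces. -/

section LinearAlgebra

open Polynomial

variable {K V N : Type*} [Field K] [AddCommGroup V] [Module K V] [AddCommGroup N] [Module K N]

/-! Write `s`, `t` for the semi-simple and nilpotent parts of `∂ = S + R`. The argument is purely
formal: both inclusions are congruences between coefficient vectors, and analyticity is then
immediate because `I` consists of convergent series. Hence no small divisors occur.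

`B(∂) ⊆ J := I𝒪̃`. Choose `i₀` with `λ_{i₀} ≠ 0` and put `g = r_{i₀} / λ_{i₀}`. Since `J` contains
`Γ(S ∧ R)`, `R ≡ gS` modulo `J`; since it contains `Γ([S, R])`, `S(g) ∈ J`. So `∂ ≡ S + gS`, where
`S` is semi-simple, `gS` is nilpotent because `g(0) = 0`, and the two commute modulo `J`. Uniqueness
of the Jordan decomposition modulo `J` (`IsJordanDecomposition.sub_mem`) yields `s ≡ S` and `t ≡
gS`, so the coefficients of `s ∧ t` lie in `J`. Uniqueness is a statement about endomorphisms of jet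
spaces, whereas coefficients are wanted: `s(x_i) - S(x_i) = x_i (s_i - S_i)` must be shown to lie in
`x_i J`, not only in `J`. The comparison is therefore made on the jets of `(x_i)` modulo those of
`x_i J`; Krull's theorem removes the truncation, and `x_i` cancels.

`J ⊆ B := B(∂)`. The normal form hypothesis gives `s ≡ S`, hence `t ≡ R`, modulo `B`. Then `s ∧ t`
and `[s, t] = 0` reduce to `S ∧ R` and `[S, R]` modulo `B` (`collinear_and_commute_mem`). As `B` is
`S`-stable, its contraction to `𝒪` contains `I`. -/

theorem aeval_intertwine {f : Module.End K V} {g : Module.End K N} (φ : V →ₗ[K] N)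
    (h : φ ∘ₗ f = g ∘ₗ φ) (p : K[X]) : φ ∘ₗ aeval f p = aeval g p ∘ₗ φ := by
  have h' : ∀ v, φ (f v) = g (φ v) := fun v => LinearMap.congr_fun h v
  induction p using Polynomial.induction_on' with
  | add p q hp hq => rw [map_add, map_add, LinearMap.comp_add, LinearMap.add_comp, hp, hq]
  | monomial k a =>
    ext v
    have hk : φ ((f ^ k) v) = (g ^ k) (φ v) := by
      induction k with
      | zero => simp
      | succ k ih => rw [pow_succ', pow_succ', Module.End.mul_apply, Module.End.mul_apply, h', ih]
    simp [aeval_monomial, hk]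

theorem isSemisimple_of_surjective [FiniteDimensional K V] {f : Module.End K V}
    {g : Module.End K N} (φ : V →ₗ[K] N) (hφ : Function.Surjective φ)
    (h : φ ∘ₗ f = g ∘ₗ φ) (hf : f.IsSemisimple) : g.IsSemisimple := by
  refine Module.End.isSemisimple_of_squarefree_aeval_eq_zero hf.minpoly_squarefree ?_
  refine LinearMap.ext fun y => ?_
  obtain ⟨x, rfl⟩ := hφ y
  have := LinearMap.congr_fun (aeval_intertwine φ h (minpoly K f)) x
  simpa [minpoly.aeval] using this.symm

theorem isNilpotent_of_surjective {f : Module.End K V}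
    {g : Module.End K N} (φ : V →ₗ[K] N) (hφ : Function.Surjective φ)
    (h : φ ∘ₗ f = g ∘ₗ φ) (hf : IsNilpotent f) : IsNilpotent g := by
  obtain ⟨k, hk⟩ := hf
  refine ⟨k, LinearMap.ext fun y => ?_⟩
  obtain ⟨x, rfl⟩ := hφ y
  have := LinearMap.congr_fun (aeval_intertwine φ h (Polynomial.X ^ k)) x
  simpa [hk] using this.symm

/-- The semi-simple part of an endomorphism preserves every invariant subspace. -/
theorem semisimplePart_mem [PerfectField K] [FiniteDimensional K V] {s t : Module.End K V}
    (hs : s.IsSemisimple) (ht : IsNilpotent t) (hst : Commute s t) {W : Submodule K V}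
    (hW : ∀ v ∈ W, (s + t) v ∈ W) : ∀ v ∈ W, s v ∈ W := by
  -- Jordan–Chevalley provides a semi-simple part `s₀` that is a polynomial in `s + t`, hence
  -- preserves `W`; uniqueness identifies it with `s`.
  obtain ⟨t₀, -, s₀, hs₀, ht₀n, hs₀s, h⟩ := (s + t).exists_isNilpotent_isSemisimple
  have hmem : ∀ a ∈ Algebra.adjoin K {s + t}, ∀ v ∈ W, a v ∈ W := by
    intro a ha
    induction ha using Algebra.adjoin_induction with
    | mem x hx => rw [Set.mem_singleton_iff.mp hx]; exact hW
    | algebraMap r => intro v hv; simpa using W.smul_mem r hv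
    | add x y _ _ hx hy => intro v hv; exact W.add_mem (hx v hv) (hy v hv)
    | mul x y _ _ hx hy => intro v hv; exact hx _ (hy v hv)
  have ht₀ : t₀ = s + t - s₀ := eq_sub_of_add_eq h.symm
  have hc : Commute t₀ s₀ := by
    have := Algebra.commute_of_mem_adjoin_self hs₀
    rw [ht₀]
    exact (this.sub_left (Commute.refl s₀))
  have := (Module.End.isNilpotent_isSemisimple_unique ht hs ht₀n hs₀s hst.symm hc
    (by rw [← h, add_comm])).2
  rw [this]
  exact hmem s₀ hs₀

/-- On `V ⧸ W` both pairs become Jordan decompositions of the same endomorphism. The second pair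
need only commute after passing to this quotient. -/
theorem semisimplePart_congr_mod [PerfectField K] [FiniteDimensional K V]
    {s t s' t' : Module.End K V} (hs : s.IsSemisimple) (ht : IsNilpotent t) (hst : Commute s t)
    (hs' : s'.IsSemisimple) (ht' : IsNilpotent t') {W : Submodule K V}
    (hW : ∀ v ∈ W, (s + t) v ∈ W) (hWs' : ∀ v ∈ W, s' v ∈ W) (hWt' : ∀ v ∈ W, t' v ∈ W)
    (hcomm : ∀ v, s' (t' v) - t' (s' v) ∈ W) (hadd : ∀ v, (s + t) v - (s' + t') v ∈ W) (v : V) :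
    s v - s' v ∈ W := by
  have hWs := semisimplePart_mem hs ht hst hW
  have hWt : ∀ v ∈ W, t v ∈ W := fun v hv => by
    have := W.sub_mem (hW v hv) (hWs v hv)
    simpa using this
  have hsurj := W.mkQ_surjective
  have key : ∀ (f : Module.End K V) (hf : ∀ v ∈ W, f v ∈ W),
      W.mkQ ∘ₗ f = (W.mapQ W f hf : Module.End K (V ⧸ W)) ∘ₗ W.mkQ := fun f hf => rfl
  have hu := Module.End.isNilpotent_isSemisimple_unique
    (n₁ := (W.mapQ W t hWt : Module.End K (V ⧸ W))) (s₁ := W.mapQ W s hWs)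
    (n₂ := W.mapQ W t' hWt') (s₂ := W.mapQ W s' hWs')
    (isNilpotent_of_surjective _ hsurj (key t hWt) ht)
    (isSemisimple_of_surjective _ hsurj (key s hWs) hs)
    (isNilpotent_of_surjective _ hsurj (key t' hWt') ht')
    (isSemisimple_of_surjective _ hsurj (key s' hWs') hs') ?_ ?_ ?_
  · have := LinearMap.congr_fun hu.2 (W.mkQ v)
    exact (Submodule.Quotient.eq W).mp this
  · refine LinearMap.ext fun y => ?_
    obtain ⟨x, rfl⟩ := hsurj y
    exact congrArg W.mkQ (LinearMap.congr_fun hst.symm.eq x)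
  · refine LinearMap.ext fun y => ?_
    obtain ⟨x, rfl⟩ := hsurj y
    refine ((Submodule.Quotient.eq W).mpr ?_).symm
    exact hcomm x
  · refine LinearMap.ext fun y => ?_
    obtain ⟨x, rfl⟩ := hsurj y
    refine (Submodule.Quotient.eq W).mpr (?_ : t x + s x - (t' x + s' x) ∈ W)
    have := hadd x
    rwa [add_comm (t x), add_comm (t' x)]

/-- If the sums of two pairs of a semi-simple and a nilpotent endomorphism agree on the subspace
`U` modulo the subspace `W`, and the pairs commute there, then so do the semi-simple terms. -/
theorem semisimplePart_congr_on_mod [PerfectField K] [FiniteDimensional K V]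
    {s t s' t' : Module.End K V} (hs : s.IsSemisimple) (ht : IsNilpotent t) (hst : Commute s t)
    (hs' : s'.IsSemisimple) (ht' : IsNilpotent t') {U W : Submodule K V}
    (hUs : ∀ v ∈ U, s v ∈ U) (hUt : ∀ v ∈ U, t v ∈ U)
    (hUs' : ∀ v ∈ U, s' v ∈ U) (hUt' : ∀ v ∈ U, t' v ∈ U)
    (hW : ∀ v ∈ W, (s + t) v ∈ W) (hWs' : ∀ v ∈ W, s' v ∈ W) (hWt' : ∀ v ∈ W, t' v ∈ W)
    (hcomm : ∀ v ∈ U, s' (t' v) - t' (s' v) ∈ W)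
    (hadd : ∀ v ∈ U, (s + t) v - (s' + t') v ∈ W) : ∀ v ∈ U, s v - s' v ∈ W := fun v hv =>
  semisimplePart_congr_mod (s := s.restrict hUs) (t := t.restrict hUt) (s' := s'.restrict hUs')
    (t' := t'.restrict hUt') (W := W.comap U.subtype)
    (hs.restrict (p := U) hUs) (Module.End.isNilpotent.restrict hUt ht)
    (LinearMap.ext fun x => Subtype.ext (LinearMap.congr_fun hst.eq x))
    (hs'.restrict (p := U) hUs') (Module.End.isNilpotent.restrict hUt' ht')
    (fun x hx => hW x hx) (fun x hx => hWs' x hx) (fun x hx => hWt' x hx)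
    (fun x => hcomm x x.2) (fun x => hadd x x.2) ⟨v, hv⟩

end LinearAlgebra

end LogField
end

noncomputable section

namespace LogField

/-! ### Jet spaces, diagonal and nilpotent derivations, Krull's theorem. -/

section Jets

variable {n : ℕ} {𝕜 : Type*} [RCLike 𝕜]

theorem coeff_X_mul_eq (i : Fin n) (f : Formal n 𝕜) (m : Fin n →₀ ℕ) :
    coeff m (X i * f) = if m i = 0 then 0 else coeff (m - Finsupp.single i 1) f := by
  classical
  have h : Finsupp.single i 1 ≤ m ↔ ¬ m i = 0 :=
    Finsupp.single_le_iff.trans Nat.one_le_iff_ne_zero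
  rw [X, coeff_monomial_mul, one_mul]
  by_cases hm : m i = 0
  · rw [if_pos hm, if_neg fun hle => h.mp hle hm]
  · rw [if_neg hm, if_pos (h.mpr hm)]

theorem mem_maxIdeal_pow_of_coeff_eq_zero (k : ℕ) :
    ∀ f : Formal n 𝕜, (∀ m : Fin n →₀ ℕ, m.degree < k → coeff m f = 0) →
      f ∈ maxIdeal n 𝕜 ^ k := by
  classical
  induction k with
  | zero => simp
  | succ k ih =>
    intro f hf
    -- Each nonconstant monomial is assigned one variable dividing it, so that `f = ∑ X i * g i`
    -- counts every monomial once. `Option` supplies a value at `m = 0` even when `n = 0`.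
    have hc : ∀ m : Fin n →₀ ℕ, ∃ i : Option (Fin n), m ≠ 0 → ∃ j, i = some j ∧ m j ≠ 0 := by
      intro m
      by_cases hm : m = 0
      · exact ⟨none, fun h => absurd hm h⟩
      · obtain ⟨j, hj⟩ := Finsupp.ne_iff.mp hm
        exact ⟨some j, fun _ => ⟨j, rfl, hj⟩⟩
    choose c hc using hc
    let g : Fin n → Formal n 𝕜 := fun i m =>
      if c (m + Finsupp.single i 1) = some i then coeff (m + Finsupp.single i 1) f else 0
    have hg : ∀ i m, coeff m (g i) =
      if c (m + Finsupp.single i 1) = some i then coeff (m + Finsupp.single i 1) f else 0 :=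
      fun i m => rfl
    have hfg : f = ∑ i, X i * g i := by
      ext m
      rw [map_sum]
      have h1 : ∀ i, m i ≠ 0 → m - Finsupp.single i 1 + Finsupp.single i 1 = m := fun i hi =>
        tsub_add_cancel_of_le (Finsupp.single_le_iff.mpr (Nat.one_le_iff_ne_zero.mpr hi))
      by_cases hm : m = 0
      · subst hm
        rw [hf 0 (by simp)]
        simp [coeff_X_mul_eq]
      · obtain ⟨j, hj, hmj⟩ := hc m hm
        rw [Finset.sum_eq_single j]
        · rw [coeff_X_mul_eq, if_neg hmj, hg, h1 j hmj, if_pos hj]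
        · intro i _ hij
          rw [coeff_X_mul_eq]
          split_ifs with h
          · rfl
          · rw [hg, h1 i h, hj, if_neg]
            exact fun h => hij (Option.some.inj h).symm
        · simp
    rw [hfg, pow_succ']
    refine Ideal.sum_mem _ fun i _ => Ideal.mul_mem_mul (Ideal.subset_span ⟨i, rfl⟩) (ih _ ?_)
    intro m hm
    rw [hg]
    split_ifs
    · exact hf _ (by simpa using hm)
    · rfl

instance finiteDimensional_jet (k : ℕ) : FiniteDimensional 𝕜 (Jet n 𝕜 k) := by
  have := (Finsupp.finite_of_degree_lt (σ := Fin n) (k + 1)).to_subtype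
  let φ : Formal n 𝕜 →ₗ[𝕜] ({m : Fin n →₀ ℕ | m.degree < k + 1} → 𝕜) :=
    LinearMap.pi fun m => coeff m.1
  have : FiniteDimensional 𝕜 (Formal n 𝕜 ⧸ LinearMap.ker φ) :=
    φ.quotKerEquivRange.symm.finiteDimensional
  have hle : LinearMap.ker φ ≤ (maxIdeal n 𝕜 ^ (k + 1)).restrictScalars 𝕜 := fun f hf =>
    mem_maxIdeal_pow_of_coeff_eq_zero (k + 1) f fun m hm =>
      congrFun (LinearMap.mem_ker.mp hf) ⟨m, hm⟩
  exact Module.Finite.of_surjective (Submodule.factor hle) (Submodule.factor_surjective hle)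

theorem mem_maxIdeal_iff {f : Formal n 𝕜} : f ∈ maxIdeal n 𝕜 ↔ constantCoeff f = 0 := by
  constructor
  · intro hf
    have : maxIdeal n 𝕜 ≤ RingHom.ker (constantCoeff (σ := Fin n) (R := 𝕜)) := by
      rw [maxIdeal, Ideal.span_le]
      rintro _ ⟨i, rfl⟩
      simp
    exact this hf
  · intro hf
    rw [← pow_one (maxIdeal n 𝕜)]
    refine mem_maxIdeal_pow_of_coeff_eq_zero 1 f fun m hm => ?_
    have : m = 0 := (Finsupp.degree_eq_zero_iff m).mp (Nat.lt_one_iff.mp hm)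
    simpa [this] using hf

theorem jetMap_mkQ (d : Fin n → Formal n 𝕜) (k : ℕ) (f : Formal n 𝕜) :
    jetMap d k (((maxIdeal n 𝕜 ^ (k + 1)).restrictScalars 𝕜).mkQ f) =
      ((maxIdeal n 𝕜 ^ (k + 1)).restrictScalars 𝕜).mkQ (derivOf euler d f) := rfl

theorem coeff_derivOf_diag (lam : Fin n → 𝕜) (f : Formal n 𝕜) (m : Fin n →₀ ℕ) :
    coeff m (derivOf euler (diag lam : Fin n → Formal n 𝕜) f) =
      (∑ i, lam i * m i) * coeff m f := by
  rw [derivOf_apply, map_sum, Finset.sum_mul]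
  refine Finset.sum_congr rfl fun i _ => ?_
  have : (diag lam : Fin n → Formal n 𝕜) i = C (lam i) := rfl
  rw [this, coeff_C_mul, coeff_euler, mul_assoc]

open Polynomial in
theorem coeff_aeval_derivOf_diag (lam : Fin n → 𝕜) (p : 𝕜[X]) (f : Formal n 𝕜)
    (m : Fin n →₀ ℕ) :
    coeff m (aeval (derivOf euler (diag lam : Fin n → Formal n 𝕜) :
      Module.End 𝕜 (Formal n 𝕜)) p f) = p.eval (∑ i, lam i * m i) * coeff m f := by
  induction p using Polynomial.induction_on' with
  | add p q hp hq => rw [map_add, LinearMap.add_apply, map_add, hp, hq, eval_add, add_mul]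
  | monomial k a =>
    have hk : coeff m (((derivOf euler (diag lam : Fin n → Formal n 𝕜) :
      Module.End 𝕜 (Formal n 𝕜)) ^ k) f) = (∑ i, lam i * m i) ^ k * coeff m f := by
      induction k with
      | zero => simp
      | succ k ih =>
        rw [pow_succ', Module.End.mul_apply]
        refine (coeff_derivOf_diag lam _ m).trans ?_
        rw [ih, pow_succ']
        ring
    rw [aeval_monomial, Module.End.mul_apply, Module.algebraMap_end_apply, MvPowerSeries.coeff_smul, hk,
      eval_monomial]
    ring

open Polynomial in
-- Monomials are eigenvectors with eigenvalues `∑ λ_i m_i` in `𝕜`. The product of `X - c` over the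
-- distinct eigenvalues in degree at most `k` is squarefree and kills the `k`-jets.
theorem isSemisimpleDer_diag (lam : Fin n → 𝕜) :
    IsSemisimpleDer (diag lam : Fin n → Formal n 𝕜) := by
  classical
  intro k
  let E : Finset 𝕜 :=
    ((Finsupp.finite_of_degree_lt (σ := Fin n) (k + 1)).image fun m => ∑ i, lam i * (m i : 𝕜)).toFinset
  have hsq : Squarefree (∏ c ∈ E, (Polynomial.X - Polynomial.C c)) :=
    (separable_prod_X_sub_C_iff'.mpr fun _ _ _ _ h => h).squarefree
  refine Module.End.isSemisimple_of_squarefree_aeval_eq_zero hsq (LinearMap.ext fun y => ?_)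
  obtain ⟨f, rfl⟩ := Submodule.mkQ_surjective _ y
  have h := LinearMap.congr_fun (aeval_intertwine
    (f := (derivOf euler (diag lam : Fin n → Formal n 𝕜) : Module.End 𝕜 (Formal n 𝕜)))
    (g := jetMap (diag lam) k)
    ((maxIdeal n 𝕜 ^ (k + 1)).restrictScalars 𝕜).mkQ rfl
    (∏ c ∈ E, (Polynomial.X - Polynomial.C c))) f
  refine h.symm.trans ((Submodule.Quotient.mk_eq_zero _).mpr ?_)
  refine mem_maxIdeal_pow_of_coeff_eq_zero (k + 1) _ fun m hm => ?_
  rw [coeff_aeval_derivOf_diag, eval_prod, Finset.prod_eq_zero (i := ∑ i, lam i * (m i : 𝕜)),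
    zero_mul]
  · simp only [E, Set.Finite.mem_toFinset]
    exact ⟨m, hm, rfl⟩
  · rw [eval_sub, eval_X, eval_C, sub_self]

theorem euler_mem_pow (i : Fin n) {k : ℕ} {f : Formal n 𝕜} (hf : f ∈ maxIdeal n 𝕜 ^ k) :
    euler i f ∈ maxIdeal n 𝕜 ^ k := by
  classical
  have h := derivOf_mem_pow (Pi.single i 1) k f hf
  rw [derivOf_apply] at h
  simpa [Pi.single_apply] using h

/-- Such a derivation maps `𝔪 ^ j` into `𝔪 ^ (j + 1)`. -/
theorem isNilpotentDer_of_mem_maxIdeal {d : Fin n → Formal n 𝕜} (hd : ∀ i, d i ∈ maxIdeal n 𝕜) :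
    IsNilpotentDer d := by
  intro k
  refine ⟨k + 1, LinearMap.ext fun y => ?_⟩
  have h : ∀ j : ℕ, ∀ f : Formal n 𝕜, ∃ g ∈ maxIdeal n 𝕜 ^ j,
      (jetMap d k ^ j) (((maxIdeal n 𝕜 ^ (k + 1)).restrictScalars 𝕜).mkQ f) =
        ((maxIdeal n 𝕜 ^ (k + 1)).restrictScalars 𝕜).mkQ g := by
    intro j f
    induction j with
    | zero => exact ⟨f, by simp, rfl⟩
    | succ j ih =>
      obtain ⟨g, hg, h⟩ := ih
      refine ⟨derivOf euler d g, ?_, ?_⟩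
      · rw [derivOf_apply, pow_succ']
        exact Ideal.sum_mem _ fun i _ => Ideal.mul_mem_mul (hd i) (euler_mem_pow i hg)
      · rw [pow_succ' (jetMap d k), Module.End.mul_apply, h, jetMap_mkQ]
  obtain ⟨f, rfl⟩ := Submodule.mkQ_surjective _ y
  obtain ⟨g, hg, h⟩ := h (k + 1) f
  exact h.trans ((Submodule.Quotient.mk_eq_zero _).mpr hg)

/-- Krull's intersection theorem for ideals of formal power series. -/
theorem mem_of_forall_mem_sup_pow {J : Ideal (Formal n 𝕜)} {f : Formal n 𝕜}
    (h : ∀ k, f ∈ J ⊔ maxIdeal n 𝕜 ^ k) : f ∈ J := by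
  have hne : maxIdeal n 𝕜 ≠ ⊤ := by
    rw [Ideal.ne_top_iff_one, mem_maxIdeal_iff]
    simp
  have : IsHausdorff (maxIdeal n 𝕜) (Formal n 𝕜 ⧸ J) := IsHausdorff.of_isLocalRing _ _ hne
  rw [← Ideal.Quotient.eq_zero_iff_mem]
  refine this.haus _ fun k => ?_
  obtain ⟨a, ha, b, hb, rfl⟩ := Submodule.mem_sup.mp (h k)
  rw [SModEq.zero, map_add, Ideal.Quotient.eq_zero_iff_mem.mpr ha, zero_add]
  have : Ideal.Quotient.mk J b = b • (1 : Formal n 𝕜 ⧸ J) :=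
    (congrArg (Ideal.Quotient.mk J) (mul_one b)).symm
  rw [this]
  exact Submodule.smul_mem_smul hb trivial

end Jets

end LogField
end

noncomputable section

namespace LogField

/-! ### Collinearity, commutativity and differential closure. -/

section LogAlgebra

variable {n : ℕ} {𝕜 A : Type*} [CommRing 𝕜] [CommRing A] [Algebra 𝕜 A]

theorem derivOf_sub_mem (E : Fin n → Derivation 𝕜 A A) {J : Ideal A} {a b : Fin n → A}
    (h : ∀ i, a i - b i ∈ J) (f : A) : derivOf E a f - derivOf E b f ∈ J := by
  rw [derivOf_apply, derivOf_apply, ← Finset.sum_sub_distrib]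
  refine Ideal.sum_mem _ fun i _ => ?_
  rw [← sub_mul]
  exact J.mul_mem_right _ (h i)

theorem derivOf_mul_left (E : Fin n → Derivation 𝕜 A A) (g : A) (a : Fin n → A) (f : A) :
    derivOf E (fun i => g * a i) f = g * derivOf E a f := by
  simp only [derivOf_apply, Finset.mul_sum, mul_assoc]

theorem derivOf_diag_self (E : Fin n → Derivation 𝕜 A A) (lam : Fin n → 𝕜) (a : Fin n → A)
    (i : Fin n) : derivOf E a ((diag lam : Fin n → A) i) = 0 := by
  simp [diag]

theorem bracket_diag (E : Fin n → Derivation 𝕜 A A) (lam : Fin n → 𝕜) (a : Fin n → A)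
    (i : Fin n) : bracket E (diag lam) a i = derivOf E (diag lam) (a i) := by
  rw [bracket, derivOf_diag_self, sub_zero]

theorem collinearityIdeal_le_iff {a b : Fin n → A} {J : Ideal A} :
    collinearityIdeal a b ≤ J ↔ ∀ i j, a i * b j - a j * b i ∈ J := by
  rw [collinearityIdeal, coeffIdeal, Ideal.span_le, Set.range_subset_iff]
  exact Prod.forall

theorem commutativityIdeal_diag_le_iff {E : Fin n → Derivation 𝕜 A A} {lam : Fin n → 𝕜}
    {a : Fin n → A} {J : Ideal A} :
    commutativityIdeal E (diag lam) a ≤ J ↔ ∀ i, derivOf E (diag lam) (a i) ∈ J := by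
  rw [commutativityIdeal, coeffIdeal, Ideal.span_le, Set.range_subset_iff]
  simp only [bracket_diag, SetLike.mem_coe]

theorem le_diffClosure (δ : Derivation 𝕜 A A) (J : Ideal A) : J ≤ diffClosure δ J :=
  le_sInf fun _ hK => hK.1

theorem diffClosure_stable (δ : Derivation 𝕜 A A) (J : Ideal A) {f : A}
    (hf : f ∈ diffClosure δ J) : δ f ∈ diffClosure δ J :=
  Submodule.mem_sInf.mpr fun K hK => hK.2 f (Submodule.mem_sInf.mp hf K hK)

theorem diffClosure_le {δ : Derivation 𝕜 A A} {J K : Ideal A} (hJ : J ≤ K)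
    (hK : ∀ f ∈ K, δ f ∈ K) : diffClosure δ J ≤ K :=
  sInf_le ⟨hJ, hK⟩

end LogAlgebra

section Field

variable {n : ℕ} {𝕜 A : Type*} [Field 𝕜] [CommRing A] [Algebra 𝕜 A]

/-- If `Γ(L(λ) ∧ a)` lies in `J`, then `a` is a multiple of `L(λ)` modulo `J`. -/
theorem sub_mul_diag_mem {lam : Fin n → 𝕜} {a : Fin n → A} {J : Ideal A}
    (h : ∀ i j, (diag lam : Fin n → A) i * a j - diag lam j * a i ∈ J) {i : Fin n}
    (hi : lam i ≠ 0) (j : Fin n) :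
    a j - algebraMap 𝕜 A (lam i)⁻¹ * a i * (diag lam : Fin n → A) j ∈ J := by
  have h1 : algebraMap 𝕜 A (lam i)⁻¹ * algebraMap 𝕜 A (lam i) = 1 := by
    rw [← map_mul, inv_mul_cancel₀ hi, map_one]
  have := J.mul_mem_left (algebraMap 𝕜 A (lam i)⁻¹) (h i j)
  rw [mul_sub, ← mul_assoc, show (diag lam : Fin n → A) i = algebraMap 𝕜 A (lam i) from rfl, h1]
    at this
  convert this using 1
  ring

end Field

/-! ### Uniqueness of the Jordan decomposition modulo an ideal. -/

section Jets

variable {n : ℕ} {𝕜 : Type*} [RCLike 𝕜]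

theorem formal_X_ne_zero (i : Fin n) : (X i : Formal n 𝕜) ≠ 0 := fun h => by
  have := congrArg (coeff (Finsupp.single i 1)) h
  rw [coeff_index_single_self_X, map_zero] at this
  exact one_ne_zero this

theorem euler_X [DecidableEq (Fin n)] (i j : Fin n) :
    euler i (X j : Formal n 𝕜) = if i = j then X j else 0 := by
  have h : euler i (X j : Formal n 𝕜) = X i * pderiv 𝕜 i (X j) := rfl
  rw [h, pderiv_X]
  split_ifs with hij <;> simp_all

theorem derivOf_X (d : Fin n → Formal n 𝕜) (i : Fin n) :
    derivOf euler d (X i) = d i * X i := by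
  classical
  simp [derivOf_apply, euler_X]

/-- The `k`-jet of `x_i f`. -/
def mulXJet (i : Fin n) (k : ℕ) : Formal n 𝕜 →ₗ[𝕜] Jet n 𝕜 k :=
  ((maxIdeal n 𝕜 ^ (k + 1)).restrictScalars 𝕜).mkQ ∘ₗ LinearMap.mulLeft 𝕜 (X i)

theorem mulXJet_apply (i : Fin n) (k : ℕ) (f : Formal n 𝕜) :
    mulXJet i k f = ((maxIdeal n 𝕜 ^ (k + 1)).restrictScalars 𝕜).mkQ (X i * f) := rfl

/-- A logarithmic derivation preserves `(x_i)`; after division by `x_i` it acts as the twisted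
operator `f ↦ d_i f + d(f)`. -/
theorem jetMap_mulXJet (d : Fin n → Formal n 𝕜) (i : Fin n) (k : ℕ) (f : Formal n 𝕜) :
    jetMap d k (mulXJet i k f) = mulXJet i k (d i * f + derivOf euler d f) := by
  have h : derivOf euler d (X i * f) = X i * (d i * f + derivOf euler d f) := by
    rw [Derivation.leibniz, derivOf_X, smul_eq_mul, smul_eq_mul]
    ring
  rw [mulXJet_apply, jetMap_mkQ, h, mulXJet_apply]

theorem IsJordanDecomposition.commute_jetMap {d s t : Fin n → Formal n 𝕜}
    (h : IsJordanDecomposition d s t) (k : ℕ) : Commute (jetMap s k) (jetMap t k) := by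
  refine LinearMap.ext fun y => ?_
  obtain ⟨f, rfl⟩ := Submodule.mkQ_surjective _ y
  refine congrArg ((maxIdeal n 𝕜 ^ (k + 1)).restrictScalars 𝕜).mkQ ?_
  have := congrArg (fun D => D f) h.commute
  rwa [Derivation.commutator_apply, Derivation.coe_zero, Pi.zero_apply, sub_eq_zero] at this

theorem IsJordanDecomposition.jetMap_add {d s t : Fin n → Formal n 𝕜}
    (h : IsJordanDecomposition d s t) (k : ℕ) : jetMap s k + jetMap t k = jetMap d k := by
  refine LinearMap.ext fun y => ?_
  obtain ⟨f, rfl⟩ := Submodule.mkQ_surjective _ y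
  refine congrArg ((maxIdeal n 𝕜 ^ (k + 1)).restrictScalars 𝕜).mkQ
    (?_ : derivOf euler s f + derivOf euler t f = derivOf euler d f)
  rw [← h.add_eq]
  simp only [derivOf_apply, Pi.add_apply, add_mul, Finset.sum_add_distrib]

theorem IsJordanDecomposition.bracket_eq_zero {d s t : Fin n → Formal n 𝕜}
    (h : IsJordanDecomposition d s t) : bracket euler s t = 0 := by
  have h0 := derivOf_bracket euler euler_comm s t
  rw [h.commute] at h0
  ext1 i
  have := derivOf_X (bracket euler s t) i
  rw [h0, Derivation.coe_zero, Pi.zero_apply] at this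
  exact (mul_eq_zero.mp this.symm).resolve_right (formal_X_ne_zero i)

/-- Uniqueness of the Jordan decomposition modulo an ideal, at the level of `k`-jets. -/
theorem IsJordanDecomposition.mul_sub_mem_sup {d s t S T : Fin n → Formal n 𝕜}
    (h : IsJordanDecomposition d s t) (hS : IsSemisimpleDer S) (hT : IsNilpotentDer T)
    {J : Ideal (Formal n 𝕜)} (hdJ : ∀ f ∈ J, derivOf euler d f ∈ J)
    (hSJ : ∀ f ∈ J, derivOf euler S f ∈ J) (hTJ : ∀ f ∈ J, derivOf euler T f ∈ J) (i : Fin n)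
    (hcomm : ∀ f, S i * (T i * f + derivOf euler T f) +
      derivOf euler S (T i * f + derivOf euler T f) -
      (T i * (S i * f + derivOf euler S f) + derivOf euler T (S i * f + derivOf euler S f)) ∈ J)
    (hadd : ∀ f, d i * f + derivOf euler d f -
      (S i * f + derivOf euler S f + (T i * f + derivOf euler T f)) ∈ J) (k : ℕ) :
    X i * (s i - S i) ∈ Ideal.span {X i} * J ⊔ maxIdeal n 𝕜 ^ (k + 1) := by
  -- `U` and `W` are the jets of `(x_i)` and of `x_i J`. Working modulo `x_i J` keeps the factor
  -- `x_i` that is cancelled later.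
  let U : Submodule 𝕜 (Jet n 𝕜 k) := LinearMap.range (mulXJet i k)
  let W : Submodule 𝕜 (Jet n 𝕜 k) := (J.restrictScalars 𝕜).map (mulXJet i k)
  have hW : ∀ f ∈ J, mulXJet i k f ∈ W := fun f hf => Submodule.mem_map_of_mem hf
  have hU : ∀ a : Fin n → Formal n 𝕜, ∀ v ∈ U, jetMap a k v ∈ U := by
    rintro a _ ⟨f, rfl⟩
    rw [jetMap_mulXJet]
    exact LinearMap.mem_range_self _ _
  have hWa : ∀ a : Fin n → Formal n 𝕜, (∀ f ∈ J, derivOf euler a f ∈ J) →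
      ∀ v ∈ W, jetMap a k v ∈ W := by
    rintro a ha _ ⟨f, hf, rfl⟩
    rw [jetMap_mulXJet]
    exact hW _ (J.add_mem (J.mul_mem_left _ hf) (ha f hf))
  have hst : ∀ v, (jetMap s k + jetMap t k) v = jetMap d k v := fun v => by
    rw [← h.jetMap_add k]
  have hmem := semisimplePart_congr_on_mod (h.semisimple k) (h.nilpotent k)
    (h.commute_jetMap k) (hS k) (hT k) (U := U) (W := W)
    (hU s) (hU t) (hU S) (hU T) (fun v hv => by rw [hst]; exact hWa d hdJ v hv)
    (hWa S hSJ) (hWa T hTJ) (by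
      rintro _ ⟨f, rfl⟩
      rw [jetMap_mulXJet, jetMap_mulXJet, jetMap_mulXJet, jetMap_mulXJet, ← map_sub]
      exact hW _ (hcomm f)) (by
      rintro _ ⟨f, rfl⟩
      rw [hst, LinearMap.add_apply, jetMap_mulXJet, jetMap_mulXJet, jetMap_mulXJet,
        ← map_add, ← map_sub]
      exact hW _ (hadd f)) (mulXJet i k 1) (LinearMap.mem_range_self _ _)
  -- The congruence was evaluated at the jet of `x_i` itself, where the twisted operators give `s_i`
  -- and `S_i`.
  rw [jetMap_mulXJet, jetMap_mulXJet, ← map_sub] at hmem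
  obtain ⟨f, hf, hfk⟩ := hmem
  have hmem' := (Submodule.Quotient.eq _).mp hfk
  refine Submodule.mem_sup.mpr ⟨X i * f,
    Ideal.mul_mem_mul (Ideal.mem_span_singleton_self _) hf, X i * (s i - S i) - X i * f, ?_,
    add_sub_cancel _ _⟩
  have h1 := neg_mem hmem'
  rw [LinearMap.mulLeft_apply, LinearMap.mulLeft_apply, Derivation.map_one_eq_zero,
    Derivation.map_one_eq_zero, mul_one, mul_one, add_zero, add_zero, neg_sub] at h1
  exact h1

theorem derivOf_euler_diag_self (lam : Fin n → 𝕜) (a : Fin n → Formal n 𝕜) (i : Fin n) :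
    derivOf euler a ((diag lam : Fin n → Formal n 𝕜) i) = 0 := by
  rw [derivOf_apply]
  refine Finset.sum_eq_zero fun j _ => ?_
  rw [diag, Derivation.map_algebraMap, mul_zero]

/-- If `d = (1 + g) S` modulo an `S`-stable ideal `J`, where `S` is semi-simple with constant
coefficients and `g` vanishes at the origin and is a first integral of `S` modulo `J`, then the
semi-simple component of `d` is `S` modulo `J`. -/
theorem IsJordanDecomposition.sub_mem {d s t : Fin n → Formal n 𝕜}
    (h : IsJordanDecomposition d s t) {J : Ideal (Formal n 𝕜)} {S : Fin n → Formal n 𝕜}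
    (hS : IsSemisimpleDer S) {g : Formal n 𝕜} (hg0 : constantCoeff g = 0)
    (hJ : ∀ f ∈ J, derivOf euler S f ∈ J) (hg : derivOf euler S g ∈ J)
    (hd : ∀ j, d j - (1 + g) * S j ∈ J) (i : Fin n) (hSi : derivOf euler S (S i) = 0) :
    s i - S i ∈ J := by
  have hTf : ∀ f, derivOf euler (fun j => g * S j) f = g * derivOf euler S f :=
    fun f => by rw [derivOf_mul_left]
  have hT : IsNilpotentDer (fun j => g * S j) := isNilpotentDer_of_mem_maxIdeal fun _ =>
    Ideal.mul_mem_right _ _ (mem_maxIdeal_iff.mpr hg0)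
  have hdST : ∀ f, derivOf euler d f - (1 + g) * derivOf euler S f ∈ J := fun f => by
    rw [← derivOf_mul_left]
    exact derivOf_sub_mem (𝕜 := 𝕜) _ hd f
  have key : X i * (s i - S i) ∈ Ideal.span {X i} * J := by
    refine mem_of_forall_mem_sup_pow fun k => ?_
    have hle : maxIdeal n 𝕜 ^ (k + 1) ≤ maxIdeal n 𝕜 ^ k := Ideal.pow_le_pow_right k.le_succ
    refine sup_le_sup_left hle _ ?_
    refine h.mul_sub_mem_sup hS hT (J := J) ?_ hJ ?_ i ?_ ?_ k
    · intro f hf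
      have := J.add_mem (hdST f) (J.mul_mem_left (1 + g) (hJ f hf))
      rwa [sub_add_cancel] at this
    · intro f hf
      rw [hTf]
      exact J.mul_mem_left g (hJ f hf)
    · intro f
      -- This is `[S, gS] = S(g) S` for the twisted operators.
      have h1 := J.mul_mem_left (S i * f + derivOf euler S f) hg
      simp only [hTf, map_add, Derivation.leibniz, smul_eq_mul, hSi]
      convert h1 using 1
      ring
    · intro f
      have h1 := J.add_mem (J.mul_mem_right f (hd i)) (hdST f)
      rw [hTf]
      convert h1 using 1
      ring
  obtain ⟨z, hz, hzs⟩ := Ideal.mem_span_singleton_mul.mp key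
  rwa [← mul_left_cancel₀ (formal_X_ne_zero i) hzs]

end Jets

end LogField
end

noncomputable section

namespace LogField

/-! ### The two inclusions. -/

section Main

variable {n : ℕ} {𝕜 : Type*} [RCLike 𝕜]

theorem isJordanDecomposition_ssPart {d : Fin n → Formal n 𝕜}
    (h : ∃ s, ∃ t, IsJordanDecomposition d s t) :
    IsJordanDecomposition d (ssPart d) (nilpPart d) := by
  have hs : ssPart d = h.choose := dif_pos h
  obtain ⟨t, ht⟩ := h.choose_spec
  rw [← hs] at ht
  have : nilpPart d = t := by rw [nilpPart, ← ht.add_eq, ht.add_eq, sub_eq_iff_eq_add', ht.add_eq]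
  rwa [this]

theorem apply_mem_of_mem_smul_top {A ι : Type*} [CommRing A] {J : Ideal A} {v : ι → A}
    (hv : v ∈ J • (⊤ : Submodule A (ι → A))) (i : ι) : v i ∈ J := by
  induction hv using Submodule.smul_induction_on' with
  | smul a ha x _ => exact J.mul_mem_right _ ha
  | add x _ y _ hx hy => exact J.add_mem hx hy

/-- Existence comes for free here: otherwise `ssPart d` takes its default value `0`, the Bruno ideal
vanishes, and the congruence forces `λ = 0`. -/
theorem IsNormalFormModulo.isJordanDecomposition {lam : Fin n → 𝕜} (hlam : lam ≠ 0)
    {d : Fin n → Formal n 𝕜} (h : IsNormalFormModulo lam d (brunoIdeal d)) :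
    IsJordanDecomposition d (ssPart d) (nilpPart d) := by
  by_cases hex : ∃ s, ∃ t, IsJordanDecomposition d s t
  · exact isJordanDecomposition_ssPart hex
  · exfalso
    have hs : ssPart d = 0 := dif_neg hex
    have hB : brunoIdeal d ≤ ⊥ := by
      rw [brunoIdeal, collinearityIdeal_le_iff]
      simp [hs]
    refine hlam (funext fun i => ?_)
    have := hB (apply_mem_of_mem_smul_top h.congruent i)
    rw [hs] at this
    simpa [diag] using this

/-- A `L(λ)`-stable ideal containing `Γ(s ∧ t)`, modulo which the semi-simple component `s` of
`L(λ) + r` is `L(λ)`, contains the ideals of collinearity and of commutativity of `L(λ)`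
and `r`. -/
theorem collinear_and_commute_mem {lam : Fin n → 𝕜} (hlam : lam ≠ 0)
    {r s t : Fin n → Formal n 𝕜} (h : IsJordanDecomposition (diag lam + r) s t)
    {B : Ideal (Formal n 𝕜)} (hB : ∀ i j, s i * t j - s j * t i ∈ B)
    (hBS : ∀ f ∈ B, derivOf euler (diag lam : Fin n → Formal n 𝕜) f ∈ B)
    (hs : ∀ i, s i - (diag lam : Fin n → Formal n 𝕜) i ∈ B) :
    (∀ i j, (diag lam : Fin n → Formal n 𝕜) i * r j - diag lam j * r i ∈ B) ∧
      ∀ i, derivOf euler (diag lam : Fin n → Formal n 𝕜) (r i) ∈ B := by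
  set S : Fin n → Formal n 𝕜 := diag lam with hS
  have hsum : ∀ i, s i + t i = S i + r i := fun i => congrFun h.add_eq i
  have ht : ∀ i, t i - r i ∈ B := fun i => by
    have h1 : t i - r i = -(s i - S i) := by linear_combination hsum i
    rw [h1]
    exact neg_mem (hs i)
  have hcol : ∀ i j, S i * r j - S j * r i ∈ B := by
    have h1 : ∀ i j, s i * t j - S i * r j ∈ B := fun i j => by
      have := B.add_mem (B.mul_mem_right (t j) (hs i)) (B.mul_mem_left (S i) (ht j))
      convert this using 1
      ring
    intro i j
    have := B.add_mem (B.sub_mem (hB i j) (h1 i j)) (h1 j i)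
    convert this using 1
    ring
  refine ⟨hcol, fun i => ?_⟩
  obtain ⟨i₀, hi₀⟩ := Function.ne_iff.mp hlam
  -- Modulo `B`, `t ≡ r ≡ (r_{i₀} / λ_{i₀}) S`, so `t` inherits stability of `B` from `S`.
  have htB : ∀ f ∈ B, derivOf euler t f ∈ B := fun f hf => by
    have h1 := derivOf_sub_mem (𝕜 := 𝕜) (A := Formal n 𝕜) euler ht f
    have h2 := derivOf_sub_mem (𝕜 := 𝕜) (A := Formal n 𝕜) euler (sub_mul_diag_mem hcol hi₀) f
    rw [derivOf_mul_left] at h2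
    have h3 := B.add_mem (B.add_mem h1 h2)
      (B.mul_mem_left (algebraMap 𝕜 (Formal n 𝕜) (lam i₀)⁻¹ * r i₀) (hBS f hf))
    convert h3 using 1
    ring
  -- Here `t(s_i) ≡ t(S_i) = 0` and `s(t_i) ≡ S(t_i) ≡ S(r_i)` modulo `B`, so the vanishing bracket
  -- leaves `S(r_i) ∈ B`.
  have hbr : derivOf euler s (t i) - derivOf euler t (s i) = 0 := congrFun h.bracket_eq_zero i
  have h1 := derivOf_sub_mem (𝕜 := 𝕜) (A := Formal n 𝕜) euler hs (t i)
  have h2 := htB _ (hs i)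
  rw [map_sub, hS, derivOf_euler_diag_self, sub_zero] at h2
  have h3 := hBS _ (ht i)
  rw [map_sub] at h3
  have := B.sub_mem (B.sub_mem h2 h1) h3
  convert this using 1
  linear_combination hbr

theorem coe_derivOf_eulerConv_diag (lam : Fin n → 𝕜) (f : Conv n 𝕜) :
    ((derivOf eulerConv (diag lam) f : Conv n 𝕜) : Formal n 𝕜) =
      derivOf euler (diag lam : Fin n → Formal n 𝕜) f := by
  rw [derivOf_apply, derivOf_apply, ← Subalgebra.coe_val, map_sum]
  rfl

theorem extend_stable {lam : Fin n → 𝕜} {I : Ideal (Conv n 𝕜)}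
    (hI : ∀ f ∈ I, derivOf eulerConv (diag lam) f ∈ I) :
    ∀ f ∈ extend I, derivOf euler (diag lam : Fin n → Formal n 𝕜) f ∈ extend I := by
  intro f hf
  refine Submodule.span_induction (p := fun f _ =>
    derivOf euler (diag lam : Fin n → Formal n 𝕜) f ∈ extend I) ?_ ?_ ?_ ?_ hf
  · rintro _ ⟨g, hg, rfl⟩
    have := Ideal.mem_map_of_mem (Conv n 𝕜).val (hI g hg)
    rwa [Subalgebra.coe_val, coe_derivOf_eulerConv_diag] at this
  · rw [map_zero]
    exact zero_mem _
  · intro x y _ _ hx hy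
    rw [map_add]
    exact add_mem hx hy
  · intro a x hx h
    rw [smul_eq_mul, Derivation.leibniz]
    exact add_mem (Ideal.mul_mem_left _ _ h) (Ideal.mul_mem_right _ _ hx)

end Main

end LogField
end
theorem mainTheorem3 {𝕜 : Type*} [RCLike 𝕜] {n : ℕ} (lam : Fin n → 𝕜) (hlam : lam ≠ 0)
    (R : Fin n → LogField.Conv n 𝕜)
    (hR : ∀ i, MvPowerSeries.constantCoeff (R i : LogField.Formal n 𝕜) = 0)
    (hnf : LogField.IsNormalFormModulo lam (LogField.toFormal (LogField.diag lam + R))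
      (LogField.brunoIdeal (LogField.toFormal (LogField.diag lam + R)))) :
    LogField.brunoIdeal (LogField.toFormal (LogField.diag lam + R)) =
        LogField.extend
          (LogField.diffClosure (LogField.derivOf LogField.eulerConv (LogField.diag lam))
            (LogField.collinearityIdeal (LogField.diag lam) R ⊔
              LogField.commutativityIdeal LogField.eulerConv (LogField.diag lam) R)) ∧
      LogField.IsAnalyticIdeal
        (LogField.brunoIdeal (LogField.toFormal (LogField.diag lam + R))) := by
  open LogField in
  suffices h : brunoIdeal (toFormal (diag lam + R)) =
      extend (diffClosure (derivOf eulerConv (diag lam))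
        (collinearityIdeal (diag lam) R ⊔ commutativityIdeal eulerConv (diag lam) R)) from
    ⟨h, _, h⟩
  set I := diffClosure (derivOf eulerConv (diag lam))
    (collinearityIdeal (diag lam) R ⊔ commutativityIdeal eulerConv (diag lam) R) with hI
  have hd : toFormal (diag lam + R) = (diag lam : Fin n → Formal n 𝕜) + toFormal R := rfl
  have hjd := hnf.isJordanDecomposition hlam
  rw [hd] at hnf hjd ⊢
  have hs := apply_mem_of_mem_smul_top hnf.congruent
  refine le_antisymm ?_ ?_
  · obtain ⟨hcol, hcom⟩ := sup_le_iff.mp (le_diffClosure (derivOf eulerConv (diag lam))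
      (collinearityIdeal (diag lam) R ⊔ commutativityIdeal eulerConv (diag lam) R))
    rw [← hI] at hcol hcom
    rw [collinearityIdeal_le_iff] at hcol
    rw [commutativityIdeal_diag_le_iff] at hcom
    have hJ := extend_stable (lam := lam) (I := I) fun f hf => diffClosure_stable _ _ hf
    have hcolJ : ∀ i j, (diag lam : Fin n → Formal n 𝕜) i * toFormal R j -
        diag lam j * toFormal R i ∈ extend I := fun i j =>
      Ideal.mem_map_of_mem (Conv n 𝕜).val (hcol i j)
    have hcomJ : ∀ i, derivOf euler (diag lam : Fin n → Formal n 𝕜) (toFormal R i) ∈ extend I :=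
      fun i => by
        have := Ideal.mem_map_of_mem (Conv n 𝕜).val (hcom i)
        rwa [Subalgebra.coe_val, coe_derivOf_eulerConv_diag] at this
    obtain ⟨i₀, hi₀⟩ := Function.ne_iff.mp hlam
    have hg := sub_mul_diag_mem hcolJ hi₀
    set g : Formal n 𝕜 := algebraMap 𝕜 (Formal n 𝕜) (lam i₀)⁻¹ * toFormal R i₀ with hgdef
    have hsJ := fun i => hjd.sub_mem (J := extend I) (g := g) (isSemisimpleDer_diag lam) (by
      have : MvPowerSeries.constantCoeff (toFormal R i₀) = 0 := hR i₀
      rw [hgdef, map_mul, this, mul_zero]) hJ (by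
      rw [hgdef, Derivation.leibniz, Derivation.map_algebraMap, smul_zero, add_zero]
      exact Ideal.mul_mem_left _ _ (hcomJ i₀)) (fun j => by
      have := hg j
      rwa [Pi.add_apply, add_mul, one_mul, add_sub_add_left_eq_sub]) i
      (derivOf_euler_diag_self lam _ i)
    rw [brunoIdeal, collinearityIdeal_le_iff]
    have ht : ∀ j, nilpPart (diag lam + toFormal R) j -
        g * (diag lam : Fin n → Formal n 𝕜) j ∈ extend I := fun j => by
      have h1 : ssPart (diag lam + toFormal R) j + nilpPart (diag lam + toFormal R) j =
        diag lam j + toFormal R j := congrFun hjd.add_eq j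
      have h2 := Ideal.sub_mem _ (hg j) (hsJ j)
      convert h2 using 1
      linear_combination h1
    have hst : ∀ i j, ssPart (diag lam + toFormal R) i * nilpPart (diag lam + toFormal R) j -
        diag lam i * (g * diag lam j) ∈ extend I := fun i j => by
      have h1 := Ideal.add_mem _ (Ideal.mul_mem_right
        (nilpPart (diag lam + toFormal R) j) _ (hsJ i))
        (Ideal.mul_mem_left _ ((diag lam : Fin n → Formal n 𝕜) i) (ht j))
      convert h1 using 1
      ring
    intro i j
    have h1 := Ideal.sub_mem _ (hst i j) (hst j i)
    convert h1 using 1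
    ring
  · obtain ⟨hcol, hcom⟩ := collinear_and_commute_mem hlam hjd
      (collinearityIdeal_le_iff.mp (le_refl (brunoIdeal (diag lam + toFormal R))))
      hnf.invariant hs
    -- Minimality of the differential closure is applied to the contraction of the Bruno ideal to
    -- convergent series.
    refine Ideal.map_le_iff_le_comap.mpr (diffClosure_le (sup_le ?_ ?_) fun f hf => ?_)
    · exact collinearityIdeal_le_iff.mpr hcol
    · refine commutativityIdeal_diag_le_iff.mpr fun i => ?_
      rw [Ideal.mem_comap, Subalgebra.coe_val, coe_derivOf_eulerConv_diag]
      exact hcom i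
    · rw [Ideal.mem_comap, Subalgebra.coe_val, coe_derivOf_eulerConv_diag]
      exact hnf.invariant _ hf
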